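/- \textbf{Setting (linear Computational Ludics).} Fix a countably infinite set of variables with a distinguished variable $x_0$ and a signature: a set $A$ of names, each $a\in A$ with an arity $\mathsf{ar}(a)\in\mathbb N$. \emph{Positive} c-designs $P$ and \emph{negative} c-designs $N$ are the possibly infinite trees generated coinductively by $$P ::= \maltese \mid \Omega \mid N_0|\overline a\langle N_1,\dots,N_k\rangle\ \ (k=\mathsf{ar}(a)),\qquad N ::= x \mid \textstyle\sum_{a\in A} a(\vec x_a).P_a ,$$ where the $\mathsf{ar}(a)$ distinct variables $\vec x_a$ are bound in $P_a$; c-designs are taken up to renaming of bound variables, which are chosen distinct from the free ones. Cut reduction is $(\sum a(\vec x_a).P_a)|\overline a\langle\vec N\rangle\longrightarrow P_a[\vec N/\vec x_a]$, and $P$ \emph{converges to} $\maltese$ if $P\longrightarrow^*\maltese$. A c-design $T$ is \emph{standard} if it contains no cut, is not a variable and contains no subdesign $N_0|\overline a\langle N_1,\dots,N_k\rangle$ in which some $N_l$ ($l\ge1$) is a variable, is not $\Omega$, is linear (in each subdesign $N_0|\overline a\langle N_1,\dots,N_k\rangle$ the sets of free variables of $N_0,\dots,N_k$ are pairwise disjoint),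 and has finitely many free variables. A positive c-design is \emph{atomic} if its free variables are among $\{x_0\}$, a negative one if it is closed. For atomic $P,N$ put $P\perp N$ iff $P[N/x_0]$ is closed and converges to $\maltese$. For a set $\mathbf T$ of atomic c-designs of one polarity, $\mathbf T^\perp$ is the set of standard atomic c-designs of the other polarity orthogonal to all elements of $\mathbf T$. An \emph{a-behaviour} is a set $\mathbf T$ of standard atomic c-designs of one polarity with $\mathbf T=\mathbf T^{\perp\perp}$. For negative a-behaviours $\mathbf N_1,\dots,\mathbf N_k$ and distinct variables $x_1,\dots,x_k$, $[\mathbf N_1/x_1,\dots,\mathbf N_k/x_k]^\perp$ denotes the set of standard positive $P$ such that $P[N_1/x_1,\dots,N_k/x_k]$ is closed and converges to $\maltese$ for all $N_i\in\mathbf N_i$; and, if $k=\mathsf{ar}(a)$, $\overline a\langle\mathbf N_1,\dots,\mathbf N_k\rangle$ is the set of all $x_0|\overline a\langle N_1,\dots,N_k\rangle$ with $N_i\in\mathbf N_i$. An \emph{$n$-ary connective} is $\alpha=(\vec z,\alpha^I,\alpha^E)$, where $\vec z=z_1,\dots,z_n$ are distinct variables different from $x_0$, and $\alpha^I,\alpha^E$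 are finite sets of negative actions $a_i(\vec x_i)$, $\vec x_i=x_{(i,1)},\dots,x_{(i,k)}$ being $k=\mathsf{ar}(a_i)$ distinct variables from $\vec z$, such that distinct actions in $\alpha^I\cup\alpha^E$ have distinct names and every $z_j$ occurs in some action of $\alpha^I\cup\alpha^E$. Write $\mathbf N_{(i,l)}=\mathbf N_j$ and $\mathbf P_{(i,l)}=\mathbf P_j$ when $x_{(i,l)}=z_j$. For negative a-behaviours $\mathbf N_j$ and positive a-behaviours $\mathbf P_j$, put $$\alpha^E\langle\mathbf N_1,\dots,\mathbf N_n\rangle=\Big(\bigcup_{a_i(\vec x_i)\in\alpha^E}\overline{a_i}\langle\mathbf N_{(i,1)},\dots,\mathbf N_{(i,k)}\rangle\Big)^{\perp\perp},$$ $$\alpha^I(\mathbf P_1,\dots,\mathbf P_n)=\bigcap_{a_i(\vec x_i)\in\alpha^I}\overline{a_i}\langle\mathbf P_{(i,1)}^\perp,\dots,\mathbf P_{(i,k)}^\perp\rangle^\perp$$ (an intersection among the standard atomic negative c-designs), and $$\alpha^I(\mathbf P_1,\dots,\mathbf P_n)^{\mathsf C}=\bigcup_{a_i(\vec x_i)\in\alpha^I}\overline{a_i}\langle\mathbf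 P_{(i,1)}^\perp,\dots,\mathbf P_{(i,k)}^\perp\rangle .$$ The connective $\alpha$ satisfies the \emph{harmony condition} if $\alpha^E\subseteq\alpha^I$ (inversion) and $\alpha^I\subseteq\alpha^E$ (recovery). \textbf{Proposition.} If an $n$-ary connective $\alpha$ satisfies the harmony condition, then $\alpha$ is dually decomposable, that is: \begin{enumerate} \item for all negative a-behaviours $\mathbf N_1,\dots,\mathbf N_n$, $$\alpha^E\langle\mathbf N_1,\dots,\mathbf N_n\rangle=\alpha^I(\mathbf N_1^\perp,\dots,\mathbf N_n^\perp)^{\mathsf C}\cup\{\maltese\};$$ \item for all positive a-behaviours $\mathbf P_1,\dots,\mathbf P_n$ and every standard atomic negative c-design $\sum a(\vec x_a).P_a$, $$\textstyle\sum a(\vec x_a).P_a\in\alpha^I(\mathbf P_1,\dots,\mathbf P_n)$$ holds if and only if $$P_{a_i}\in[\mathbf P_{(i,1)}^\perp/x_{(i,1)},\dots,\mathbf P_{(i,k)}^\perp/x_{(i,k)}]^\perp$$ for every $a_i(x_{(i,1)},\dots,x_{(i,k)})\in\alpha^E$, where the bound variables $\vec x_{a_i}$ are taken to be $\vec x_i$.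 \end{enumerate} -/

import Mathlib

/-!
Linear computational ludics.

C-designs are taken up to renaming of bound variables, by means of de Bruijn indices.  Variables
are natural numbers.  In `∑ a(x₁,…,x_k).P_a` the branch `P_a` refers to the bound variables
`x₁, …, x_k` by the indices `0, …, k-1` and to a variable `m` that is not bound there by `k + m`.
The distinguished variable `x₀` is the variable `0`.
-/

universe u

namespace Ludics

/-- A signature: a set of names, each with an arity. -/
structure Signature where
  Name : Type u
  ar : Name → ℕ

/-- One layer of a negative c-design with positive subdesigns in `X`: a variable, or a family
`∑ a(x⃗_a).P_a` indexed by all names. -/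
inductive NegF (S : Signature.{u}) (X : Type u) : Type u where
  | var (x : ℕ) : NegF S X
  | sum (P : S.Name → X) : NegF S X

/-- One layer of a positive c-design with deeper positive subdesigns in `X`: daimon, divergence, or
`N₀ | ā⟨N₁,…,N_k⟩` with `k` the arity of `a`. -/
inductive PosF (S : Signature.{u}) (X : Type u) : Type u where
  | daimon : PosF S X
  | omega : PosF S X
  | act (a : S.Name) (N₀ : NegF S X) (N : Fin (S.ar a) → NegF S X) : PosF S X

namespace NegF

variable {S : Signature.{u}} {X Y : Type u}

def map (f : X → Y) : NegF S X → NegF S Y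
  | var x => var x
  | sum P => sum fun a => f (P a)

/-- The variable at the root, if the root is a variable. -/
def var? : NegF S X → Option ℕ
  | var x => some x
  | sum _ => none

/-- The branches at the root, if the root is not a variable. -/
def branch : (N : NegF S X) → N.var? = none → S.Name → X
  | var _, h => nomatch h
  | sum P, _ => P

def ofParts : (v : Option ℕ) → (v = none → S.Name → X) → NegF S X
  | some x, _ => var x
  | none, P => sum (P rfl)

theorem ofParts_branch (N : NegF S X) : ofParts N.var? N.branch = N := by
  cases N <;> rfl

theorem map_ofParts (f : X → Y) (v : Option ℕ) (P : v = none → S.Name → X) :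
    (ofParts v P).map f = ofParts v fun h a => f (P h a) := by
  cases v <;> rfl

end NegF

namespace PosF

variable {S : Signature.{u}} {X Y : Type u}

def map (f : X → Y) : PosF S X → PosF S Y
  | daimon => daimon
  | omega => omega
  | act a N₀ N => act a (N₀.map f) fun l => (N l).map f

instance : Functor (PosF S) where
  map := map

/-- The shapes of one layer of a positive c-design; `v none` and `v (some l)` tell whether `N₀` and
`N_l` are variables, and which. -/
inductive Shape (S : Signature.{u}) : Type u where
  | daimon : Shape S
  | omega : Shape S
  | act (a : S.Name) (v : Option (Fin (S.ar a)) → Option ℕ) : Shape S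

/-- The deeper positive subdesigns of a layer of the given shape. -/
def Slot : Shape S → Type u
  | Shape.daimon => PEmpty
  | Shape.omega => PEmpty
  | Shape.act _ v => {l // v l = none} × S.Name

def poly (S : Signature.{u}) : PFunctor.{u, u} := ⟨Shape S, Slot⟩

def ofPoly : poly S X → PosF S X
  | ⟨Shape.daimon, _⟩ => daimon
  | ⟨Shape.omega, _⟩ => omega
  | ⟨Shape.act a v, f⟩ =>
      act a (NegF.ofParts (v none) fun h b => f (⟨none, h⟩, b))
        fun l => NegF.ofParts (v (some l)) fun h b => f (⟨some l, h⟩, b)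

/-- The immediate negative subdesigns of `N₀ | ā⟨N₁,…,N_k⟩`. -/
def child {k : ℕ} (N₀ : NegF S X) (N : Fin k → NegF S X) : Option (Fin k) → NegF S X
  | none => N₀
  | some l => N l

def toPoly : PosF S X → poly S X
  | daimon => ⟨Shape.daimon, fun i => nomatch i⟩
  | omega => ⟨Shape.omega, fun i => nomatch i⟩
  | act a N₀ N => ⟨Shape.act a fun l => (child N₀ N l).var?,
      fun i => (child N₀ N i.1.1).branch i.1.2 i.2⟩

/-- One-layer positive c-designs form a polynomial functor, so that the largest set of labelled
trees with these layers is available as `QPF.Cofix`. -/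
instance : QPF (PosF S) where
  P := poly S
  abs := ofPoly
  repr := toPoly
  abs_repr := by
    rintro α (_ | _ | ⟨a, N₀, N⟩)
    · rfl
    · rfl
    · show act a _ _ = _
      congr 1
      · exact NegF.ofParts_branch N₀
      · funext l
        exact NegF.ofParts_branch (N l)
  abs_map := by
    rintro α β f ⟨_ | _ | ⟨a, v⟩, g⟩
    · rfl
    · rfl
    · show act a _ _ = act a _ _
      congr 1
      · exact (NegF.map_ofParts f _ _).symm
      · funext l
        exact (NegF.map_ofParts f _ _).symm

end PosF

/-- Positive c-designs: the possibly infinite trees whose layers are as in `PosF`. -/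
def Pos (S : Signature.{u}) : Type u := QPF.Cofix (PosF S)

/-- Negative c-designs. -/
abbrev Neg (S : Signature.{u}) : Type u := NegF S (Pos S)

/-- C-designs of either polarity. -/
inductive Design (S : Signature.{u}) : Type u where
  | pos (P : Pos S) : Design S
  | neg (N : Neg S) : Design S

variable {S : Signature.{u}}

namespace Pos

/-- The root layer of a positive c-design. -/
def dest (P : Pos S) : PosF S (Pos S) := QPF.Cofix.dest P

/-- Definition by corecursion. -/
def corec {X : Type u} (f : X → PosF S X) (x : X) : Pos S := QPF.Cofix.corec f x

theorem dest_corec {X : Type u} (f : X → PosF S X) (x : X) :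
    dest (corec f x) = (f x).map (corec f) := QPF.Cofix.dest_corec f x

/-- The positive c-design with a given root layer. -/
def mk : PosF S (Pos S) → Pos S := corec (PosF.map dest)

theorem mk_dest (P : Pos S) : mk P.dest = P := by
  refine QPF.Cofix.bisim_rel (fun x y => x = mk (dest y)) ?_ _ _ rfl
  rintro _ y rfl
  have h : QPF.Cofix.dest (mk (dest y)) = (fun z => mk (dest z)) <$> QPF.Cofix.dest y := by
    have h1 := dest_corec (PosF.map dest) (dest y)
    have h2 : PosF.map (mk (S := S)) (PosF.map dest (dest y))
        = mk <$> dest <$> QPF.Cofix.dest y := rfl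
    have h3 := QPF.comp_map (F := PosF S) dest mk (QPF.Cofix.dest y)
    exact h1.trans (h2.trans h3.symm)
  rw [h]
  refine (QPF.comp_map (F := PosF S) (fun z => mk (dest z)) (Quot.mk _) _).symm.trans ?_
  refine congrArg (fun g => g <$> QPF.Cofix.dest y) (funext fun z => ?_)
  exact Quot.sound rfl

theorem dest_mk (P : PosF S (Pos S)) : dest (mk P) = P := by
  have h1 : dest (mk P) = (P.map dest).map mk := dest_corec _ _
  have h2 : (P.map dest).map mk = (fun z => mk (dest z)) <$> P :=
    (QPF.comp_map (F := PosF S) dest mk P).symm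
  have h3 : (fun z : Pos S => mk (dest z)) = id := funext mk_dest
  rw [h1, h2, h3]
  exact QPF.id_map P

def daimon : Pos S := mk PosF.daimon

def omega : Pos S := mk PosF.omega

/-- `N₀ | ā⟨N₁,…,N_k⟩`. -/
def act (a : S.Name) (N₀ : Neg S) (N : Fin (S.ar a) → Neg S) : Pos S := mk (PosF.act a N₀ N)

end Pos

/-! ### Renaming and substitution -/

/-- A renaming carried under a binder of `k` variables. -/
def liftRen (k : ℕ) (ρ : ℕ → ℕ) (i : ℕ) : ℕ := if i < k then i else ρ (i - k) + k

/-- One layer of a renaming. -/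
def NegF.renameStep (ρ : ℕ → ℕ) : Neg S → NegF S ((ℕ → ℕ) × Pos S)
  | var x => var (ρ x)
  | sum P => sum fun a => (liftRen (S.ar a) ρ, P a)

def PosF.renameStep (ρ : ℕ → ℕ) : PosF S (Pos S) → PosF S ((ℕ → ℕ) × Pos S)
  | daimon => daimon
  | omega => omega
  | act a N₀ N => act a (N₀.renameStep ρ) fun l => (N l).renameStep ρ

/-- Renaming of the free variables of a positive c-design. -/
def Pos.rename (ρ : ℕ → ℕ) (P : Pos S) : Pos S :=
  Pos.corec (fun s : (ℕ → ℕ) × Pos S => s.2.dest.renameStep s.1) (ρ, P)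

/-- Renaming of the free variables of a negative c-design. -/
def NegF.rename (ρ : ℕ → ℕ) (N : Neg S) : Neg S :=
  (N.renameStep ρ).map fun s => s.2.rename s.1

/-- A simultaneous substitution carried under a binder of `k` variables. -/
def liftSubst (k : ℕ) (σ : ℕ → Neg S) (i : ℕ) : Neg S :=
  if i < k then NegF.var i else (σ (i - k)).rename (· + k)

/-- One layer of a substitution.  A substituted c-design is copied, that is, traversed with the
identical substitution. -/
def NegF.substStep (σ : ℕ → Neg S) : Neg S → NegF S ((ℕ → Neg S) × Pos S)
  | var x => (σ x).map fun P => (NegF.var, P)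
  | sum P => sum fun a => (liftSubst (S.ar a) σ, P a)

def PosF.substStep (σ : ℕ → Neg S) : PosF S (Pos S) → PosF S ((ℕ → Neg S) × Pos S)
  | daimon => daimon
  | omega => omega
  | act a N₀ N => act a (N₀.substStep σ) fun l => (N l).substStep σ

/-- Simultaneous capture-avoiding substitution `P[σ x / x]` for all variables `x`. -/
def Pos.subst (σ : ℕ → Neg S) (P : Pos S) : Pos S :=
  Pos.corec (fun s : (ℕ → Neg S) × Pos S => s.2.dest.substStep s.1) (σ, P)

/-- The substitution `[N / x₀]`. -/
def single (N : Neg S) (x : ℕ) : Neg S := if x = 0 then N else NegF.var x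

/-- The substitution `[N₁ / x₁, …, N_k / x_k]` that removes a binder of the variables
`x₁, …, x_k`. -/
def instantiate {k : ℕ} (N : Fin k → Neg S) (i : ℕ) : Neg S :=
  if h : i < k then N ⟨i, h⟩ else NegF.var (i - k)

/-! ### Subdesigns, free variables, standard c-designs -/

/-- `Subdesign U T`: `U` is a subtree of `T`. -/
inductive Subdesign (U : Design S) : Design S → Prop
  | refl : Subdesign U U
  | head {a : S.Name} {N₀ : Neg S} {N : Fin (S.ar a) → Neg S} :
      Subdesign U (Design.neg N₀) → Subdesign U (Design.pos (Pos.act a N₀ N))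
  | arg {a : S.Name} {N₀ : Neg S} {N : Fin (S.ar a) → Neg S} (l : Fin (S.ar a)) :
      Subdesign U (Design.neg (N l)) → Subdesign U (Design.pos (Pos.act a N₀ N))
  | branch {P : S.Name → Pos S} (a : S.Name) :
      Subdesign U (Design.pos (P a)) → Subdesign U (Design.neg (NegF.sum P))

/-- `FreeIn x T`: the variable `x` occurs free in `T`. -/
inductive FreeIn : ℕ → Design S → Prop
  | var (x : ℕ) : FreeIn x (Design.neg (NegF.var x))
  | head {x : ℕ} {a : S.Name} {N₀ : Neg S} {N : Fin (S.ar a) → Neg S} :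
      FreeIn x (Design.neg N₀) → FreeIn x (Design.pos (Pos.act a N₀ N))
  | arg {x : ℕ} {a : S.Name} {N₀ : Neg S} {N : Fin (S.ar a) → Neg S} (l : Fin (S.ar a)) :
      FreeIn x (Design.neg (N l)) → FreeIn x (Design.pos (Pos.act a N₀ N))
  | branch {x : ℕ} {P : S.Name → Pos S} (a : S.Name) :
      FreeIn (S.ar a + x) (Design.pos (P a)) → FreeIn x (Design.neg (NegF.sum P))

namespace Design

/-- The set of free variables. -/
def fv (T : Design S) : Set ℕ := {x | FreeIn x T}

def Closed (T : Design S) : Prop := T.fv = ∅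

/-- A cut is a positive c-design `(∑ a(x⃗_a).P_a) | ā⟨N₁,…,N_k⟩`. -/
def IsCut (T : Design S) : Prop :=
  ∃ (a : S.Name) (P : S.Name → Pos S) (N : Fin (S.ar a) → Neg S),
    T = pos (Pos.act a (NegF.sum P) N)

def CutFree (T : Design S) : Prop := ∀ U, Subdesign U T → ¬ U.IsCut

/-- `T` is not a variable, and no argument of a positive action in `T` is a variable. -/
def IdentityFree (T : Design S) : Prop :=
  (∀ x, T ≠ neg (NegF.var x)) ∧
  ∀ (a : S.Name) (N₀ : Neg S) (N : Fin (S.ar a) → Neg S),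
    Subdesign (pos (Pos.act a N₀ N)) T → ∀ l x, N l ≠ NegF.var x

def Total (T : Design S) : Prop := T ≠ pos Pos.omega

/-- For every subdesign `N₀ | ā⟨N₁,…,N_k⟩` the sets of free variables of `N₀, N₁, …, N_k` are
pairwise disjoint. -/
def Linear (T : Design S) : Prop :=
  ∀ (a : S.Name) (N₀ : Neg S) (N : Fin (S.ar a) → Neg S),
    Subdesign (pos (Pos.act a N₀ N)) T →
      (∀ l, Disjoint (neg N₀).fv (neg (N l)).fv) ∧
      ∀ l m, l ≠ m → Disjoint (neg (N l)).fv (neg (N m)).fv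

structure Standard (T : Design S) : Prop where
  cutFree : T.CutFree
  identityFree : T.IdentityFree
  total : T.Total
  linear : T.Linear
  finite_fv : T.fv.Finite

/-- A positive c-design is atomic if its only possible free variable is `x₀`, a negative one if it
is closed. -/
def Atomic : Design S → Prop
  | pos P => (pos P).fv ⊆ {0}
  | neg N => (neg N).fv = ∅

end Design

/-! ### Reduction and orthogonality -/

/-- Cut reduction `(∑ a(x⃗_a).P_a) | ā⟨N⃗⟩ ⟶ P_a[N⃗ / x⃗_a]`. -/
inductive Step : Pos S → Pos S → Prop
  | cut (a : S.Name) (P : S.Name → Pos S) (N : Fin (S.ar a) → Neg S) :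
      Step (Pos.act a (NegF.sum P) N) ((P a).subst (instantiate N))

/-- `P ⇓ Q`. -/
def Evaluates (P Q : Pos S) : Prop :=
  Relation.ReflTransGen Step P Q ∧ ¬ (Design.pos Q).IsCut ∧ Q ≠ Pos.omega

/-- `P` converges to the daimon, that is, the normal form of `P` is the daimon: `P ⇓ ✠`. -/
def Converges (P : Pos S) : Prop := Evaluates P Pos.daimon

/-- Orthogonality of atomic c-designs: `P[N / x₀]` is closed and converges to the daimon. -/
def Orth (P : Pos S) (N : Neg S) : Prop :=
  (Design.pos (P.subst (single N))).Closed ∧ Converges (P.subst (single N))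

/-- `𝐓^⊥` for a set `𝐓` of atomic positive c-designs. -/
def orthPos (T : Set (Pos S)) : Set (Neg S) :=
  {N | (Design.neg N).Standard ∧ (Design.neg N).Atomic ∧ ∀ P ∈ T, Orth P N}

/-- `𝐓^⊥` for a set `𝐓` of atomic negative c-designs. -/
def orthNeg (T : Set (Neg S)) : Set (Pos S) :=
  {P | (Design.pos P).Standard ∧ (Design.pos P).Atomic ∧ ∀ N ∈ T, Orth P N}

/-- A positive a-behaviour: a set of standard atomic positive c-designs with `𝐏 = 𝐏^⊥⊥`. -/
def IsPosABehaviour (B : Set (Pos S)) : Prop :=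
  (∀ P ∈ B, (Design.pos P).Standard ∧ (Design.pos P).Atomic) ∧ B = orthNeg (orthPos B)

/-- A negative a-behaviour: a set of standard atomic negative c-designs with `𝐍 = 𝐍^⊥⊥`. -/
def IsNegABehaviour (B : Set (Neg S)) : Prop :=
  (∀ N ∈ B, (Design.neg N).Standard ∧ (Design.neg N).Atomic) ∧ B = orthPos (orthNeg B)

/-- An anti-design against positives, `[N₁ / x₁, …, N_n / x_n]` with base `{x₁, …, x_n}`. -/
structure AntiDesign (S : Signature.{u}) where
  base : Finset ℕ
  design : base → Neg S
  atomic : ∀ x, (Design.neg (design x)).Atomic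

namespace AntiDesign

/-- The substitution given by an anti-design. -/
def toSubst (G : AntiDesign S) (x : ℕ) : Neg S :=
  if h : x ∈ G.base then G.design ⟨x, h⟩ else NegF.var x

/-- `P ⊥ [G]`: `P[N₁ / x₁, …, N_n / x_n]` is closed and converges to the daimon. -/
def Orth (P : Pos S) (G : AntiDesign S) : Prop :=
  (Design.pos (P.subst G.toSubst)).Closed ∧ Converges (P.subst G.toSubst)

/-- `𝒢^⊥` for a set `𝒢` of anti-designs against positives. -/
def orthSet (𝒢 : Set (AntiDesign S)) : Set (Pos S) :=
  {P | (Design.pos P).Standard ∧ ∀ G ∈ 𝒢, Orth P G}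

/-- The set `[𝐍₁ / x₁, …, 𝐍_k / x_k]` of all `[N₁ / x₁, …, N_k / x_k]` with `N_i ∈ 𝐍_i`, for
the variables `x₁, …, x_k` with the indices `0, …, k-1`. -/
def family {k : ℕ} (N : Fin k → Set (Neg S)) : Set (AntiDesign S) :=
  {G | ∃ h : G.base = Finset.range k,
    ∀ l : Fin k, G.design ⟨l, by rw [h]; exact Finset.mem_range.2 l.2⟩ ∈ N l}

end AntiDesign

/-! ### Connectives -/

/-- A proper negative action `a(x₁,…,x_k)` with distinct variables among `z₁, …, z_n`; the variable
`z_j` is represented by `j`. -/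
structure NegAction (S : Signature.{u}) (n : ℕ) where
  name : S.Name
  vars : Fin (S.ar name) ↪ Fin n

/-- An `n`-ary connective `(z⃗, α^I, α^E)`, up to renaming of the bound variables `z⃗`. -/
structure Connective (S : Signature.{u}) (n : ℕ) where
  intro : Set (NegAction S n)
  elim : Set (NegAction S n)
  finite_intro : intro.Finite
  finite_elim : elim.Finite
  name_injOn : Set.InjOn NegAction.name (intro ∪ elim)
  covers : ∀ j : Fin n, ∃ p ∈ intro ∪ elim, j ∈ Set.range p.vars

/-- `ā⟨𝐍₁,…,𝐍_k⟩`: all `x₀ | ā⟨N₁,…,N_k⟩` with `N_i ∈ 𝐍_i`. -/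
def actSet (a : S.Name) (N : Fin (S.ar a) → Set (Neg S)) : Set (Pos S) :=
  {P | ∃ M : Fin (S.ar a) → Neg S, (∀ l, M l ∈ N l) ∧ P = Pos.act a (NegF.var 0) M}

namespace Connective

variable {n : ℕ}

/-- `α^E⟨𝐍₁,…,𝐍_n⟩ = (⋃ ā_i⟨𝐍_{(i,1)},…,𝐍_{(i,k)}⟩)^⊥⊥`, over `a_i(x⃗_i)` in `α^E`. -/
def elimBehaviour (α : Connective S n) (N : Fin n → Set (Neg S)) : Set (Pos S) :=
  orthNeg (orthPos (⋃ p ∈ α.elim, actSet p.name fun l => N (p.vars l)))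

/-- `α^I(𝐏₁,…,𝐏_n) = ⋂ ā_i⟨𝐏^⊥_{(i,1)},…,𝐏^⊥_{(i,k)}⟩^⊥`, over `a_i(x⃗_i)` in `α^I`; the
intersection is taken among the standard atomic negative c-designs. -/
def introBehaviour (α : Connective S n) (P : Fin n → Set (Pos S)) : Set (Neg S) :=
  {N | (Design.neg N).Standard ∧ (Design.neg N).Atomic ∧
    ∀ p ∈ α.intro, N ∈ orthPos (actSet p.name fun l => orthPos (P (p.vars l)))}

/-- The counter set `α^I(𝐏₁,…,𝐏_n)^C = ⋃ ā_i⟨𝐏^⊥_{(i,1)},…,𝐏^⊥_{(i,k)}⟩`, over `a_i(x⃗_i)` in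
`α^I`. -/
def introCounterSet (α : Connective S n) (P : Fin n → Set (Pos S)) : Set (Pos S) :=
  ⋃ p ∈ α.intro, actSet p.name fun l => orthPos (P (p.vars l))

def Inversion (α : Connective S n) : Prop := α.elim ⊆ α.intro

def Recovery (α : Connective S n) : Prop := α.intro ⊆ α.elim

/-- The harmony condition. -/
def Harmony (α : Connective S n) : Prop := α.Inversion ∧ α.Recovery

/-- Dual decomposability.  In the second condition `∑ a(x⃗_a).P_a` is a standard atomic c-design,
since these are the c-designs among which negative a-behaviours are formed. -/
def DuallyDecomposable (α : Connective S n) : Prop :=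
  (∀ N : Fin n → Set (Neg S), (∀ j, IsNegABehaviour (N j)) →
    α.elimBehaviour N = α.introCounterSet (fun j => orthNeg (N j)) ∪ {Pos.daimon}) ∧
  (∀ P : Fin n → Set (Pos S), (∀ j, IsPosABehaviour (P j)) →
    ∀ Q : S.Name → Pos S,
      (Design.neg (NegF.sum Q)).Standard → (Design.neg (NegF.sum Q)).Atomic →
      (NegF.sum Q ∈ α.introBehaviour P ↔
        ∀ p ∈ α.elim,
          Q p.name ∈ AntiDesign.orthSet (AntiDesign.family fun l => orthPos (P (p.vars l)))))

end Connective

end Ludics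

/-! Harmony says that `intro` and `elim` are the same set of actions, so both halves concern one
set.

Both rest on one computation (`orth_act_iff`): for closed `M` and a closed sum, putting the sum for
`x₀` in `x₀ | ā⟨M⟩` gives a cut, and its only reduct is the branch `Q a` with `M` filled in.
Orthogonality to an action is thus a property of a single branch. This is the second half, up to the
demand that the branch be standard, in particular not `Ω`. Orthogonals are never empty
(`sum_daimon_mem_orthPos`), so some instance of the branch converges, and `Ω` never does.

The first half is internal completeness (`orthNeg_orthPos_actUnion`): the biorthogonal of the union
of actions adds only the daimon. Its other elements have the form `x₀ | ā⟨M⟩` with `M` standard and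
closed, and are probed by two kinds of sums. With `Ω` at `a` and daimons elsewhere, the sum forces
`a` to be the name of a listed action. With a counter-design `R` of `𝐍` at `a`, acting on the `l`-th
bound variable, and daimons elsewhere, it forces `M l ⊥ R`; hence `M l` lies in `𝐍^⊥⊥ = 𝐍`.

The preceding lemmas are the coinductive calculus of renaming and substitution, and the fact that
such sums are standard. -/

namespace Ludics

variable {S : Signature.{u}}

/-! ### Coinduction -/

/-- Relation lifting for one layer of a negative c-design. -/
inductive NegF.Rel {X Y : Type u} (R : X → Y → Prop) : NegF S X → NegF S Y → Prop
  | var (x : ℕ) : NegF.Rel R (NegF.var x) (NegF.var x)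
  | sum {P : S.Name → X} {Q : S.Name → Y} :
      (∀ a, R (P a) (Q a)) → NegF.Rel R (NegF.sum P) (NegF.sum Q)

/-- Relation lifting for one layer of a positive c-design. -/
inductive PosF.Rel {X Y : Type u} (R : X → Y → Prop) : PosF S X → PosF S Y → Prop
  | daimon : PosF.Rel R PosF.daimon PosF.daimon
  | omega : PosF.Rel R PosF.omega PosF.omega
  | act {a : S.Name} {N₀ : NegF S X} {N : Fin (S.ar a) → NegF S X}
      {M₀ : NegF S Y} {M : Fin (S.ar a) → NegF S Y} :
      NegF.Rel R N₀ M₀ → (∀ l, NegF.Rel R (N l) (M l)) →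
      PosF.Rel R (PosF.act a N₀ N) (PosF.act a M₀ M)

theorem NegF.Rel.refl {X : Type u} {R : X → X → Prop} (hR : ∀ x, R x x) (N : NegF S X) :
    NegF.Rel R N N := by
  cases N
  · exact .var _
  · exact .sum fun _ => hR _

theorem PosF.Rel.refl {X : Type u} {R : X → X → Prop} (hR : ∀ x, R x x) (P : PosF S X) :
    PosF.Rel R P P := by
  cases P
  · exact .daimon
  · exact .omega
  · exact .act (.refl hR _) fun _ => .refl hR _

/-- `QPF.Cofix.bisim` expects a lifted relation as one layer labelled by related pairs; the
inductive form is more convenient to prove. -/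
theorem NegF.Rel.exists_pairs {X Y : Type u} {R : X → Y → Prop} {N : NegF S X} {M : NegF S Y}
    (h : NegF.Rel R N M) :
    ∃ u : NegF S {p : X × Y // R p.1 p.2},
      u.map (fun p => p.1.1) = N ∧ u.map (fun p => p.1.2) = M := by
  cases h with
  | var x => exact ⟨.var x, rfl, rfl⟩
  | sum h => exact ⟨.sum fun a => ⟨(_, _), h a⟩, rfl, rfl⟩

theorem PosF.Rel.exists_pairs {X Y : Type u} {R : X → Y → Prop} {P : PosF S X} {Q : PosF S Y}
    (h : PosF.Rel R P Q) :
    ∃ u : PosF S {p : X × Y // R p.1 p.2},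
      u.map (fun p => p.1.1) = P ∧ u.map (fun p => p.1.2) = Q := by
  cases h with
  | daimon => exact ⟨.daimon, rfl, rfl⟩
  | omega => exact ⟨.omega, rfl, rfl⟩
  | act h₀ h =>
    obtain ⟨u₀, rfl, rfl⟩ := h₀.exists_pairs
    choose u hu hu' using fun l => (h l).exists_pairs
    obtain rfl := funext hu
    obtain rfl := funext hu'
    exact ⟨.act _ u₀ u, rfl, rfl⟩

theorem Pos.bisim (R : Pos S → Pos S → Prop) (h : ∀ P Q, R P Q → PosF.Rel R P.dest Q.dest)
    {P Q : Pos S} (hPQ : R P Q) : P = Q := by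
  refine QPF.Cofix.bisim R (fun x y hxy => ?_) P Q hPQ
  obtain ⟨u, hu, hu'⟩ := (h x y hxy).exists_pairs
  exact ⟨u, hu, hu'⟩

/-! ### Layers -/

namespace Pos

@[simp] theorem dest_daimon : (daimon : Pos S).dest = .daimon := dest_mk _

@[simp] theorem dest_omega : (omega : Pos S).dest = .omega := dest_mk _

@[simp] theorem dest_act (a : S.Name) (N₀ : Neg S) (N : Fin (S.ar a) → Neg S) :
    (act a N₀ N).dest = .act a N₀ N := dest_mk _

theorem dest_injective : Function.Injective (dest : Pos S → PosF S (Pos S)) :=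
  Function.LeftInverse.injective mk_dest

theorem eq_daimon_or_omega_or_act (P : Pos S) :
    P = daimon ∨ P = omega ∨ ∃ a N₀ N, P = act a N₀ N := by
  rcases h : P.dest with _ | _ | ⟨a, N₀, N⟩
  · exact .inl (dest_injective (by simp [h]))
  · exact .inr (.inl (dest_injective (by simp [h])))
  · exact .inr (.inr ⟨a, N₀, N, dest_injective (by simp [h])⟩)

/-- `Pos.act` is a function into a final coalgebra, not a constructor, so equations between
c-designs are inverted through `dest` instead of by `cases`. -/
theorem act_inj {a b : S.Name} {N₀ M₀ : Neg S} {N : Fin (S.ar a) → Neg S}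
    {M : Fin (S.ar b) → Neg S} (h : act a N₀ N = act b M₀ M) :
    a = b ∧ N₀ = M₀ ∧ N ≍ M := by
  have := congrArg dest h
  simpa using this

theorem act_ne_daimon (a : S.Name) (N₀ : Neg S) (N : Fin (S.ar a) → Neg S) :
    act a N₀ N ≠ daimon := fun h => by simpa using congrArg dest h

theorem act_ne_omega (a : S.Name) (N₀ : Neg S) (N : Fin (S.ar a) → Neg S) :
    act a N₀ N ≠ omega := fun h => by simpa using congrArg dest h

theorem daimon_ne_omega : (daimon : Pos S) ≠ omega := fun h => by simpa using congrArg dest h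

end Pos

/-! ### Renaming -/

theorem liftRen_injective (k : ℕ) {ρ : ℕ → ℕ} (hρ : Function.Injective ρ) :
    Function.Injective (liftRen k ρ) := by
  intro i j h
  unfold liftRen at h
  split_ifs at h
  · exact h
  · omega
  · omega
  · have := hρ (Nat.add_right_cancel h)
    omega

theorem Pos.dest_rename (ρ : ℕ → ℕ) (P : Pos S) :
    (P.rename ρ).dest = (P.dest.renameStep ρ).map fun s => s.2.rename s.1 :=
  Pos.dest_corec _ _

@[simp] theorem NegF.rename_var (ρ : ℕ → ℕ) (x : ℕ) :
    (NegF.var x : Neg S).rename ρ = NegF.var (ρ x) := rfl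

@[simp] theorem Pos.rename_daimon (ρ : ℕ → ℕ) : (daimon : Pos S).rename ρ = daimon :=
  dest_injective (by rw [dest_rename, dest_daimon]; rfl)

@[simp] theorem Pos.rename_omega (ρ : ℕ → ℕ) : (omega : Pos S).rename ρ = omega :=
  dest_injective (by rw [dest_rename, dest_omega]; rfl)

@[simp] theorem Pos.rename_act (ρ : ℕ → ℕ) (a : S.Name) (N₀ : Neg S)
    (N : Fin (S.ar a) → Neg S) :
    (act a N₀ N).rename ρ = act a (N₀.rename ρ) fun l => (N l).rename ρ :=
  dest_injective (by rw [dest_rename, dest_act, dest_act]; rfl)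

/-- Renaming of the free variables of a c-design of either polarity. -/
def Design.rename (ρ : ℕ → ℕ) : Design S → Design S
  | pos P => pos (P.rename ρ)
  | neg N => neg (N.rename ρ)

theorem Pos.eq_act_of_rename_eq {ρ : ℕ → ℕ} {P : Pos S} {a : S.Name} {M₀ : Neg S}
    {M : Fin (S.ar a) → Neg S} (h : P.rename ρ = act a M₀ M) :
    ∃ N₀ N, P = act a N₀ N ∧ M₀ = N₀.rename ρ ∧ M = fun l => (N l).rename ρ := by
  rcases P.eq_daimon_or_omega_or_act with rfl | rfl | ⟨b, N₀, N, rfl⟩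
  · rw [rename_daimon] at h
    exact absurd h.symm (act_ne_daimon _ _ _)
  · rw [rename_omega] at h
    exact absurd h.symm (act_ne_omega _ _ _)
  · rw [rename_act] at h
    obtain ⟨rfl, rfl, hM⟩ := act_inj h
    exact ⟨N₀, N, rfl, rfl, (eq_of_heq hM).symm⟩

theorem Design.rename_eq_act {ρ : ℕ → ℕ} {T : Design S} {a : S.Name} {M₀ : Neg S}
    {M : Fin (S.ar a) → Neg S} (h : pos (Pos.act a M₀ M) = T.rename ρ) :
    ∃ N₀ N, T = pos (Pos.act a N₀ N) ∧ M₀ = N₀.rename ρ ∧ M = fun l => (N l).rename ρ := by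
  rcases T with P | N
  · obtain ⟨N₀, N, rfl, hN⟩ := Pos.eq_act_of_rename_eq (Design.pos.inj h).symm
    exact ⟨N₀, N, rfl, hN⟩
  · cases h

theorem Design.rename_eq_sum {ρ : ℕ → ℕ} {T : Design S} {Q : S.Name → Pos S}
    (h : neg (NegF.sum Q) = T.rename ρ) :
    ∃ P, T = neg (NegF.sum P) ∧ ∀ a, Q a = (P a).rename (liftRen (S.ar a) ρ) := by
  rcases T with P | (x | P)
  · cases h
  · cases h
  · cases h
    exact ⟨P, rfl, fun _ => rfl⟩

theorem Design.rename_eq_var {ρ : ℕ → ℕ} {T : Design S} {x : ℕ}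
    (h : neg (NegF.var x) = T.rename ρ) : ∃ y, T = neg (NegF.var y) ∧ x = ρ y := by
  rcases T with P | (y | P) <;> cases h
  exact ⟨y, rfl, rfl⟩

theorem FreeIn.of_rename {x : ℕ} {U : Design S} (h : FreeIn x U) :
    ∀ {ρ : ℕ → ℕ} {T : Design S}, U = T.rename ρ → ∃ y, FreeIn y T ∧ x = ρ y := by
  induction h with
  | var x =>
    intro ρ T h
    obtain ⟨y, rfl, rfl⟩ := Design.rename_eq_var h
    exact ⟨y, .var y, rfl⟩
  | head _ ih =>
    intro ρ T h
    obtain ⟨N₀, N, rfl, rfl, -⟩ := Design.rename_eq_act h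
    obtain ⟨y, hy, rfl⟩ := ih (T := .neg N₀) rfl
    exact ⟨y, .head hy, rfl⟩
  | arg l _ ih =>
    intro ρ T h
    obtain ⟨N₀, N, rfl, -, rfl⟩ := Design.rename_eq_act h
    obtain ⟨y, hy, rfl⟩ := ih (T := .neg (N l)) rfl
    exact ⟨y, .arg l hy, rfl⟩
  | branch a _ ih =>
    intro ρ T h
    obtain ⟨P, rfl, hP⟩ := Design.rename_eq_sum h
    obtain ⟨y, hy, h⟩ := ih (T := .pos (P a)) (by rw [hP]; rfl)
    unfold liftRen at h
    -- A bound `y` is fixed by the lifted renaming and stays below the arity, while the variable in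
    -- question is at least the arity.
    split_ifs at h with hya
    · omega
    · refine ⟨y - S.ar a, .branch a ?_, by omega⟩
      rwa [Nat.add_sub_cancel' (not_lt.1 hya)]

/-- Each binder passed on the way down lifts the renaming, so the subdesign comes with its own `ρ'`;
lifting preserves injectivity. -/
theorem Subdesign.of_rename {U V : Design S} (h : Subdesign U V) :
    ∀ {ρ : ℕ → ℕ} {T : Design S}, Function.Injective ρ → V = T.rename ρ →
      ∃ (ρ' : ℕ → ℕ) (U' : Design S),
        Function.Injective ρ' ∧ Subdesign U' T ∧ U = U'.rename ρ' := by
  induction h with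
  | refl => exact fun {ρ T} hρ h => ⟨ρ, T, hρ, .refl, h⟩
  | head _ ih =>
    intro ρ T hρ h
    obtain ⟨N₀, N, rfl, rfl, -⟩ := Design.rename_eq_act h
    obtain ⟨ρ', U', hρ', hU', rfl⟩ := ih (T := .neg N₀) hρ rfl
    exact ⟨ρ', U', hρ', .head hU', rfl⟩
  | arg l _ ih =>
    intro ρ T hρ h
    obtain ⟨N₀, N, rfl, -, rfl⟩ := Design.rename_eq_act h
    obtain ⟨ρ', U', hρ', hU', rfl⟩ := ih (T := .neg (N l)) hρ rfl
    exact ⟨ρ', U', hρ', .arg l hU', rfl⟩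
  | branch a _ ih =>
    intro ρ T hρ h
    obtain ⟨P, rfl, hP⟩ := Design.rename_eq_sum h
    obtain ⟨ρ', U', hρ', hU', rfl⟩ :=
      ih (T := .pos (P a)) (liftRen_injective _ hρ) (by rw [hP]; rfl)
    exact ⟨ρ', U', hρ', .branch a hU', rfl⟩

/-! ### Substitution -/

/-- Simultaneous substitution in a negative c-design. -/
def NegF.subst (σ : ℕ → Neg S) (N : Neg S) : Neg S := (N.substStep σ).map fun s => s.2.subst s.1

theorem Pos.dest_subst (σ : ℕ → Neg S) (P : Pos S) :
    (P.subst σ).dest = (P.dest.substStep σ).map fun s => s.2.subst s.1 :=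
  Pos.dest_corec _ _

@[simp] theorem Pos.subst_daimon (σ : ℕ → Neg S) : (daimon : Pos S).subst σ = daimon :=
  dest_injective (by rw [dest_subst, dest_daimon]; rfl)

@[simp] theorem Pos.subst_omega (σ : ℕ → Neg S) : (omega : Pos S).subst σ = omega :=
  dest_injective (by rw [dest_subst, dest_omega]; rfl)

theorem Pos.subst_act (σ : ℕ → Neg S) (a : S.Name) (N₀ : Neg S)
    (N : Fin (S.ar a) → Neg S) :
    (act a N₀ N).subst σ = act a (N₀.subst σ) fun l => (N l).subst σ :=
  dest_injective (by rw [dest_subst, dest_act, dest_act]; rfl)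

theorem NegF.subst_sum (σ : ℕ → Neg S) (P : S.Name → Pos S) :
    (NegF.sum P : Neg S).subst σ = NegF.sum fun a => (P a).subst (liftSubst (S.ar a) σ) := rfl

theorem liftSubst_var (k : ℕ) : liftSubst k (NegF.var : ℕ → Neg S) = NegF.var := by
  funext i
  unfold liftSubst
  split_ifs with h
  · rfl
  · rw [NegF.rename_var, Nat.sub_add_cancel (not_lt.1 h)]

theorem liftSubst_liftRen (k : ℕ) (σ : ℕ → Neg S) (ρ : ℕ → ℕ) (i : ℕ) :
    liftSubst k σ (liftRen k ρ i) = liftSubst k (σ ∘ ρ) i := by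
  unfold liftSubst liftRen
  split_ifs <;> simp_all

/-- Substitution copies an inserted c-design by traversing it with the identity; this lemma makes
the copy equal to the original, as `NegF.subst_var` needs. -/
theorem Pos.subst_var (P : Pos S) : P.subst NegF.var = P := by
  refine Pos.bisim (fun P Q => P = Q.subst NegF.var) ?_ rfl
  rintro _ P rfl
  have hneg : ∀ N : Neg S,
      NegF.Rel (fun P Q => P = Q.subst NegF.var) (N.subst NegF.var) N := by
    rintro (x | P)
    · exact .var x
    · rw [NegF.subst_sum]
      exact .sum fun a => by rw [liftSubst_var]
  rcases P.eq_daimon_or_omega_or_act with rfl | rfl | ⟨a, N₀, N, rfl⟩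
  · rw [subst_daimon, dest_daimon]
    exact .daimon
  · rw [subst_omega, dest_omega]
    exact .omega
  · rw [subst_act, dest_act, dest_act]
    exact .act (hneg _) fun _ => hneg _

@[simp] theorem NegF.subst_var (σ : ℕ → Neg S) (x : ℕ) :
    (NegF.var x : Neg S).subst σ = σ x := by
  show ((σ x).map fun P => ((NegF.var : ℕ → Neg S), P)).map (fun s => s.2.subst s.1) = σ x
  cases σ x with
  | var y => rfl
  | sum P => exact congrArg NegF.sum (funext fun a => (P a).subst_var)

theorem Pos.subst_congr {σ τ : ℕ → Neg S} {P : Pos S}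
    (h : ∀ x ∈ (Design.pos P).fv, σ x = τ x) : P.subst σ = P.subst τ := by
  -- Equality is a disjunct because, once a variable is reached, both sides go on inside the same
  -- inserted c-design.
  let R (P Q : Pos S) : Prop := P = Q ∨ ∃ T σ τ,
    (∀ x ∈ (Design.pos T).fv, σ x = τ x) ∧ P = T.subst σ ∧ Q = T.subst τ
  refine Pos.bisim R ?_ (.inr ⟨P, σ, τ, h, rfl, rfl⟩)
  rintro _ _ (rfl | ⟨P, σ, τ, h, rfl, rfl⟩)
  · exact .refl (fun _ => .inl rfl) _
  have hneg : ∀ N : Neg S, (∀ x ∈ (Design.neg N).fv, σ x = τ x) →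
      NegF.Rel R (N.subst σ) (N.subst τ) := by
    rintro (x | P) h
    · rw [NegF.subst_var, NegF.subst_var, h x (.var x)]
      exact .refl (fun _ => .inl rfl) _
    · refine .sum fun a => .inr ⟨P a, _, _, fun x hx => ?_, rfl, rfl⟩
      show liftSubst _ σ x = liftSubst _ τ x
      unfold liftSubst
      split_ifs with hxa
      · rfl
      · rw [h (x - S.ar a) (.branch a (by rwa [Nat.add_sub_cancel' (not_lt.1 hxa)]))]
  rcases P.eq_daimon_or_omega_or_act with rfl | rfl | ⟨a, N₀, N, rfl⟩
  · rw [subst_daimon, subst_daimon, dest_daimon]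
    exact .daimon
  · rw [subst_omega, subst_omega, dest_omega]
    exact .omega
  · rw [subst_act, subst_act, dest_act, dest_act]
    exact .act (hneg _ fun x hx => h x (.head hx)) fun l => hneg _ fun x hx => h x (.arg l hx)

theorem Pos.subst_rename (σ : ℕ → Neg S) (ρ : ℕ → ℕ) (P : Pos S) :
    (P.rename ρ).subst σ = P.subst (σ ∘ ρ) := by
  let R (P Q : Pos S) : Prop := P = Q ∨ ∃ T σ ρ,
    P = (Pos.rename ρ T).subst σ ∧ Q = T.subst (σ ∘ ρ)
  refine Pos.bisim R ?_ (.inr ⟨P, σ, ρ, rfl, rfl⟩)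
  rintro _ _ (rfl | ⟨P, σ, ρ, rfl, rfl⟩)
  · exact .refl (fun _ => .inl rfl) _
  have hneg : ∀ N : Neg S, NegF.Rel R ((N.rename ρ).subst σ) (N.subst (σ ∘ ρ)) := by
    rintro (x | P)
    · rw [NegF.rename_var, NegF.subst_var, NegF.subst_var]
      exact .refl (fun _ => .inl rfl) _
    · refine .sum fun a => .inr ⟨P a, liftSubst (S.ar a) σ, liftRen (S.ar a) ρ, rfl, ?_⟩
      exact congrArg (fun τ => (P a).subst τ) (funext fun i => (liftSubst_liftRen _ σ ρ i).symm)
  rcases P.eq_daimon_or_omega_or_act with rfl | rfl | ⟨a, N₀, N, rfl⟩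
  · rw [rename_daimon, subst_daimon, subst_daimon, dest_daimon]
    exact .daimon
  · rw [rename_omega, subst_omega, subst_omega, dest_omega]
    exact .omega
  · rw [rename_act, subst_act, subst_act, dest_act, dest_act]
    exact .act (hneg _) fun _ => hneg _

theorem NegF.subst_of_closed {N : Neg S} (h : (Design.neg N).Closed) (σ : ℕ → Neg S) :
    N.subst σ = N := by
  have hx : ∀ x, ¬ FreeIn x (Design.neg N) := Set.eq_empty_iff_forall_notMem.1 h
  rcases N with x | P
  · exact absurd (.var x) (hx x)
  · rw [NegF.subst_sum]
    refine congrArg NegF.sum (funext fun a => ?_)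
    -- With the right side read as an identity substitution, the two substitutions need only agree
    -- on the bound variables, the only ones free in `P a`.
    conv_rhs => rw [← Pos.subst_var (P a)]
    refine Pos.subst_congr fun x hxP => ?_
    unfold liftSubst
    split_ifs with hxa
    · rfl
    · exact absurd (.branch a (by rwa [Nat.add_sub_cancel' (not_lt.1 hxa)])) (hx (x - S.ar a))

/-! ### Free variables -/

theorem freeIn_var_iff {x y : ℕ} : FreeIn x (Design.neg (NegF.var y : Neg S)) ↔ x = y := by
  refine ⟨fun h => ?_, fun h => h ▸ .var x⟩
  cases h
  rfl

theorem freeIn_sum_iff {x : ℕ} {P : S.Name → Pos S} :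
    FreeIn x (Design.neg (NegF.sum P)) ↔ ∃ a, FreeIn (S.ar a + x) (Design.pos (P a)) := by
  refine ⟨fun h => ?_, fun ⟨a, h⟩ => .branch a h⟩
  cases h with
  | branch a h => exact ⟨a, h⟩

theorem freeIn_act_iff {x : ℕ} {a : S.Name} {N₀ : Neg S} {N : Fin (S.ar a) → Neg S} :
    FreeIn x (Design.pos (Pos.act a N₀ N)) ↔
      FreeIn x (Design.neg N₀) ∨ ∃ l, FreeIn x (Design.neg (N l)) := by
  refine ⟨fun h => ?_, ?_⟩
  · generalize hT : Design.pos (Pos.act a N₀ N) = T at h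
    cases h with
    | head h =>
      obtain ⟨rfl, rfl, -⟩ := Pos.act_inj (Design.pos.inj hT)
      exact .inl h
    | arg l h =>
      obtain ⟨rfl, -, hN⟩ := Pos.act_inj (Design.pos.inj hT)
      obtain rfl := eq_of_heq hN
      exact .inr ⟨l, h⟩
    | _ => cases hT
  · rintro (h | ⟨l, h⟩)
    · exact .head h
    · exact .arg l h

theorem not_freeIn_daimon (x : ℕ) : ¬ FreeIn x (Design.pos (Pos.daimon : Pos S)) := by
  intro h
  generalize hT : Design.pos (Pos.daimon : Pos S) = T at h
  cases h with
  | head h => exact Pos.act_ne_daimon _ _ _ (Design.pos.inj hT).symm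
  | arg l h => exact Pos.act_ne_daimon _ _ _ (Design.pos.inj hT).symm
  | _ => cases hT

theorem not_freeIn_omega (x : ℕ) : ¬ FreeIn x (Design.pos (Pos.omega : Pos S)) := by
  intro h
  generalize hT : Design.pos (Pos.omega : Pos S) = T at h
  cases h with
  | head h => exact Pos.act_ne_omega _ _ _ (Design.pos.inj hT).symm
  | arg l h => exact Pos.act_ne_omega _ _ _ (Design.pos.inj hT).symm
  | _ => cases hT

/-- Substitution in a c-design of either polarity. -/
def Design.subst (σ : ℕ → Neg S) : Design S → Design S
  | pos P => pos (P.subst σ)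
  | neg N => neg (N.subst σ)

theorem FreeIn.of_subst {x : ℕ} {U : Design S} (h : FreeIn x U) :
    ∀ {σ : ℕ → Neg S} {T : Design S}, U = T.subst σ →
      ∃ y, FreeIn y T ∧ FreeIn x (Design.neg (σ y)) := by
  have hact : ∀ {a : S.Name} {M₀ : Neg S} {M : Fin (S.ar a) → Neg S} {σ : ℕ → Neg S}
      {T : Design S}, Design.pos (Pos.act a M₀ M) = T.subst σ →
      ∃ N₀ N, T = .pos (Pos.act a N₀ N) ∧ M₀ = N₀.subst σ ∧ M = fun l => (N l).subst σ := by
    intro a M₀ M σ T h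
    rcases T with P | N
    · have h := Design.pos.inj h
      rcases P.eq_daimon_or_omega_or_act with rfl | rfl | ⟨b, N₀, N, rfl⟩
      · rw [Pos.subst_daimon] at h
        exact absurd h (Pos.act_ne_daimon _ _ _)
      · rw [Pos.subst_omega] at h
        exact absurd h (Pos.act_ne_omega _ _ _)
      · rw [Pos.subst_act] at h
        obtain ⟨rfl, rfl, hM⟩ := Pos.act_inj h
        exact ⟨N₀, N, rfl, rfl, eq_of_heq hM⟩
    · cases h
  induction h with
  | var x =>
    intro σ T h
    rcases T with P | (y | P)
    · cases h
    · refine ⟨y, .var y, ?_⟩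
      rw [← NegF.subst_var σ y, ← Design.neg.inj h]
      exact .var x
    · cases h
  | head _ ih =>
    intro σ T h
    obtain ⟨N₀, N, rfl, rfl, -⟩ := hact h
    obtain ⟨y, hy, h⟩ := ih (T := .neg N₀) rfl
    exact ⟨y, .head hy, h⟩
  | arg l _ ih =>
    intro σ T h
    obtain ⟨N₀, N, rfl, -, rfl⟩ := hact h
    obtain ⟨y, hy, h⟩ := ih (T := .neg (N l)) rfl
    exact ⟨y, .arg l hy, h⟩
  | branch a hx ih =>
    intro σ T h
    rcases T with P | (y | P)
    · cases h
    · refine ⟨y, .var y, ?_⟩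
      rw [← NegF.subst_var σ y, ← Design.neg.inj h]
      exact .branch a hx
    · obtain rfl := NegF.sum.inj (Design.neg.inj h)
      obtain ⟨y, hy, h⟩ := ih (T := .pos (P a)) rfl
      change FreeIn _ (.neg (liftSubst (S.ar a) σ y)) at h
      unfold liftSubst at h
      -- A bound `y` is replaced by itself, which is below the arity. Otherwise the inserted
      -- c-design was shifted past the binder, and the shift is undone.
      split_ifs at h with hya
      · have := freeIn_var_iff.1 h
        omega
      · obtain ⟨z, hz, h⟩ := FreeIn.of_rename h (T := .neg (σ (y - S.ar a))) rfl
        obtain rfl := Nat.add_left_cancel (h.trans (add_comm z _))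
        exact ⟨y - S.ar a, .branch a (by rwa [Nat.add_sub_cancel' (not_lt.1 hya)]), hz⟩

theorem Design.closed_subst {σ : ℕ → Neg S} {P : Pos S}
    (h : ∀ x ∈ (Design.pos P).fv, (Design.neg (σ x)).Closed) :
    (Design.pos (P.subst σ)).Closed := by
  refine Set.eq_empty_iff_forall_notMem.2 fun x hx => ?_
  obtain ⟨y, hy, hxy⟩ := FreeIn.of_subst hx (σ := σ) (T := .pos P) rfl
  exact Set.eq_empty_iff_forall_notMem.1 (h y hy) x hxy
/-! ### Subdesigns and standard c-designs -/

theorem Subdesign.trans {U V W : Design S} (hUV : Subdesign U V) (hVW : Subdesign V W) :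
    Subdesign U W := by
  induction hVW with
  | refl => exact hUV
  | head _ ih => exact .head ih
  | arg l _ ih => exact .arg l ih
  | branch a _ ih => exact .branch a ih

theorem subdesign_act_iff {U : Design S} {a : S.Name} {N₀ : Neg S} {N : Fin (S.ar a) → Neg S} :
    Subdesign U (Design.pos (Pos.act a N₀ N)) ↔
      U = Design.pos (Pos.act a N₀ N) ∨ Subdesign U (Design.neg N₀) ∨
        ∃ l, Subdesign U (Design.neg (N l)) := by
  refine ⟨fun h => ?_, ?_⟩
  · generalize hT : Design.pos (Pos.act a N₀ N) = T at h
    cases h with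
    | refl => exact .inl rfl
    | head h =>
      obtain ⟨rfl, rfl, -⟩ := Pos.act_inj (Design.pos.inj hT)
      exact .inr (.inl h)
    | arg l h =>
      obtain ⟨rfl, -, hN⟩ := Pos.act_inj (Design.pos.inj hT)
      obtain rfl := eq_of_heq hN
      exact .inr (.inr ⟨l, h⟩)
    | branch => cases hT
  · rintro (rfl | h | ⟨l, h⟩)
    · exact .refl
    · exact .head h
    · exact .arg l h

theorem subdesign_sum_iff {U : Design S} {P : S.Name → Pos S} :
    Subdesign U (Design.neg (NegF.sum P)) ↔
      U = Design.neg (NegF.sum P) ∨ ∃ a, Subdesign U (Design.pos (P a)) := by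
  refine ⟨fun h => ?_, ?_⟩
  · cases h with
    | refl => exact .inl rfl
    | branch a h => exact .inr ⟨a, h⟩
  · rintro (rfl | ⟨a, h⟩)
    · exact .refl
    · exact .branch a h

theorem subdesign_var_iff {U : Design S} {x : ℕ} :
    Subdesign U (Design.neg (NegF.var x)) ↔ U = Design.neg (NegF.var x) := by
  refine ⟨fun h => ?_, fun h => h ▸ .refl⟩
  cases h
  rfl

theorem subdesign_daimon_iff {U : Design S} :
    Subdesign U (Design.pos Pos.daimon) ↔ U = Design.pos Pos.daimon := by
  refine ⟨fun h => ?_, fun h => h ▸ .refl⟩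
  generalize hT : Design.pos (Pos.daimon : Pos S) = T at h
  cases h with
  | refl => rfl
  | head h => exact absurd (Design.pos.inj hT).symm (Pos.act_ne_daimon _ _ _)
  | arg l h => exact absurd (Design.pos.inj hT).symm (Pos.act_ne_daimon _ _ _)
  | branch => cases hT

theorem subdesign_omega_iff {U : Design S} :
    Subdesign U (Design.pos Pos.omega) ↔ U = Design.pos Pos.omega := by
  refine ⟨fun h => ?_, fun h => h ▸ .refl⟩
  generalize hT : Design.pos (Pos.omega : Pos S) = T at h
  cases h with
  | refl => rfl
  | head h => exact absurd (Design.pos.inj hT).symm (Pos.act_ne_omega _ _ _)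
  | arg l h => exact absurd (Design.pos.inj hT).symm (Pos.act_ne_omega _ _ _)
  | branch => cases hT

namespace Design

/-- The part of standardness that concerns each positive action in `T` separately: its head is a
variable, no argument is a variable, and the sets of free variables are disjoint. -/
def LocallyStandard (T : Design S) : Prop :=
  ∀ (a : S.Name) (N₀ : Neg S) (N : Fin (S.ar a) → Neg S),
    Subdesign (pos (Pos.act a N₀ N)) T →
      (∃ x, N₀ = NegF.var x) ∧ (∀ l x, N l ≠ NegF.var x) ∧
      (∀ l, Disjoint (neg N₀).fv (neg (N l)).fv) ∧
      ∀ l m, l ≠ m → Disjoint (neg (N l)).fv (neg (N m)).fv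

theorem LocallyStandard.mono {T U : Design S} (h : T.LocallyStandard) (hUT : Subdesign U T) :
    U.LocallyStandard := fun a N₀ N hN => h a N₀ N (hN.trans hUT)

/-- A head is a variable or a sum, so being cut-free means that every head is a variable. The local
part passes to subdesigns and tolerates `Ω`, which branches of a standard sum may be; the rest
concerns only `T` itself. -/
theorem standard_iff {T : Design S} :
    T.Standard ↔
      T.LocallyStandard ∧ (∀ x, T ≠ neg (NegF.var x)) ∧ T ≠ pos Pos.omega ∧ T.fv.Finite := by
  refine ⟨fun h => ⟨fun a N₀ N hN => ⟨?_, h.identityFree.2 a N₀ N hN, h.linear a N₀ N hN⟩,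
    h.identityFree.1, h.total, h.finite_fv⟩, fun ⟨h, hx, hΩ, hfin⟩ => ⟨?_, ⟨hx, ?_⟩, hΩ, ?_, hfin⟩⟩
  · rcases N₀ with x | P
    · exact ⟨x, rfl⟩
    · exact absurd ⟨a, P, N, rfl⟩ (h.cutFree _ hN)
  · rintro _ hU ⟨a, P, N, rfl⟩
    obtain ⟨x, hx⟩ := (h a _ N hU).1
    cases hx
  · exact fun a N₀ N hN => (h a N₀ N hN).2.1
  · exact fun a N₀ N hN => (h a N₀ N hN).2.2

theorem locallyStandard_daimon : (pos (Pos.daimon : Pos S)).LocallyStandard := fun a N₀ N h =>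
  absurd (pos.inj (subdesign_daimon_iff.1 h)) (Pos.act_ne_daimon a N₀ N)

theorem locallyStandard_omega : (pos (Pos.omega : Pos S)).LocallyStandard := fun a N₀ N h =>
  absurd (pos.inj (subdesign_omega_iff.1 h)) (Pos.act_ne_omega a N₀ N)

theorem locallyStandard_sum {P : S.Name → Pos S} (h : ∀ a, (pos (P a)).LocallyStandard) :
    (neg (NegF.sum P)).LocallyStandard := by
  intro a N₀ N hN
  rcases subdesign_sum_iff.1 hN with hN | ⟨b, hN⟩
  · cases hN
  · exact h b a N₀ N hN

theorem LocallyStandard.rename {T : Design S} (h : T.LocallyStandard) {ρ : ℕ → ℕ}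
    (hρ : Function.Injective ρ) : (T.rename ρ).LocallyStandard := by
  intro a M₀ M hM
  obtain ⟨ρ', U, hρ', hU, hUM⟩ := hM.of_rename hρ rfl
  obtain ⟨N₀, N, rfl, rfl, rfl⟩ := rename_eq_act hUM
  obtain ⟨⟨x, rfl⟩, hid, hdisj₀, hdisj⟩ := h a N₀ N hU
  -- Injectivity of the renaming is what keeps disjoint sets of free variables disjoint.
  have key : ∀ V W : Design S, Disjoint V.fv W.fv →
      Disjoint (V.rename ρ').fv (W.rename ρ').fv := by
    intro V W hVW
    refine Set.disjoint_left.2 fun z hzV hzW => ?_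
    obtain ⟨y, hy, rfl⟩ := FreeIn.of_rename hzV rfl
    obtain ⟨y', hy', hyy'⟩ := FreeIn.of_rename hzW rfl
    obtain rfl := hρ' hyy'
    exact Set.disjoint_left.1 hVW hy hy'
  refine ⟨⟨_, rfl⟩, fun l y hy => ?_, fun l => key _ (neg (N l)) (hdisj₀ l),
    fun l m hlm => key (neg (N l)) (neg (N m)) (hdisj l m hlm)⟩
  cases hl : N l with
  | var z => exact hid l z hl
  | sum P =>
    simp only [hl] at hy
    cases hy

theorem standard_sum {P : S.Name → Pos S} (h : ∀ a, (pos (P a)).LocallyStandard)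
    (hc : (neg (NegF.sum P)).Closed) : (neg (NegF.sum P)).Standard :=
  standard_iff.2 ⟨locallyStandard_sum h, fun x hx => (by cases hx), fun hΩ => (by cases hΩ),
    by rw [hc]; exact Set.finite_empty⟩

theorem closed_sum_iff {P : S.Name → Pos S} :
    (neg (NegF.sum P)).Closed ↔ ∀ a, ∀ x ∈ (pos (P a)).fv, x < S.ar a := by
  refine Set.eq_empty_iff_forall_notMem.trans ⟨fun h a x hx => ?_, fun h x hx => ?_⟩
  · by_contra hxa
    exact h (x - S.ar a) (.branch a (by rwa [Nat.add_sub_cancel' (not_lt.1 hxa)]))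
  · obtain ⟨a, ha⟩ := freeIn_sum_iff.1 hx
    have := h a _ ha
    omega

theorem standard_daimon : (pos (Pos.daimon : Pos S)).Standard :=
  standard_iff.2 ⟨locallyStandard_daimon, fun x hx => (by cases hx),
    fun h => Pos.daimon_ne_omega (pos.inj h),
    (Set.finite_empty).subset fun x hx => absurd hx (not_freeIn_daimon x)⟩

theorem atomic_daimon : (pos (Pos.daimon : Pos S)).Atomic :=
  fun x hx => absurd hx (not_freeIn_daimon x)

/-- The arguments of a standard atomic action on `x₀` are standard and closed. -/
theorem Standard.eq_daimon_or_act {P : Pos S} (h : (pos P).Standard) (ha : (pos P).Atomic) :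
    P = Pos.daimon ∨ ∃ a N, P = Pos.act a (NegF.var 0) N ∧
      ∀ l, (neg (N l)).Standard ∧ (neg (N l)).Closed := by
  obtain ⟨hloc, -, hΩ, -⟩ := standard_iff.1 h
  rcases P.eq_daimon_or_omega_or_act with rfl | rfl | ⟨a, N₀, N, rfl⟩
  · exact .inl rfl
  · exact absurd rfl hΩ
  · obtain ⟨⟨x, rfl⟩, hid, hdisj, -⟩ := hloc a N₀ N .refl
    obtain rfl : x = 0 := ha (.head (.var x))
    refine .inr ⟨a, N, rfl, fun l => ?_⟩
    have hc : (neg (N l)).Closed := by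
      refine Set.eq_empty_iff_forall_notMem.2 fun y hy => ?_
      obtain rfl : y = 0 := ha (.arg l hy)
      exact Set.disjoint_left.1 (hdisj l) (.var 0) hy
    refine ⟨standard_iff.2 ⟨hloc.mono (.arg l .refl), fun x hx => hid l x (neg.inj hx), ?_, ?_⟩, hc⟩
    · intro h
      cases h
    · rw [hc]
      exact Set.finite_empty

theorem standard_act {a : S.Name} {N : Fin (S.ar a) → Neg S}
    (h : ∀ l, (neg (N l)).Standard ∧ (neg (N l)).Closed) :
    (pos (Pos.act a (NegF.var 0) N)).Standard ∧ (pos (Pos.act a (NegF.var 0) N)).Atomic := by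
  have hat : (pos (Pos.act a (NegF.var 0) N)).Atomic := by
    intro x hx
    rcases freeIn_act_iff.1 hx with hx | ⟨l, hx⟩
    · exact freeIn_var_iff.1 hx
    · exact absurd hx (Set.eq_empty_iff_forall_notMem.1 (h l).2 x)
  refine ⟨standard_iff.2 ⟨fun b M₀ M hM => ?_, fun x hx => (by cases hx),
    fun h => Pos.act_ne_omega _ _ _ (pos.inj h), (Set.finite_singleton 0).subset hat⟩, hat⟩
  rcases subdesign_act_iff.1 hM with hM | hM | ⟨l, hM⟩
  · obtain ⟨rfl, rfl, hMN⟩ := Pos.act_inj (pos.inj hM)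
    obtain rfl := eq_of_heq hMN
    refine ⟨⟨0, rfl⟩, fun l x => ?_, fun l => ?_, fun l m _ => ?_⟩
    · exact fun hx => (h l).1.identityFree.1 x (by rw [hx])
    · rw [show (neg (M l)).fv = ∅ from (h l).2]
      exact Set.disjoint_empty _
    · rw [show (neg (M l)).fv = ∅ from (h l).2]
      exact Set.empty_disjoint _
  · cases subdesign_var_iff.1 hM
  · exact (standard_iff.1 (h l).1).1 b M₀ M hM

end Design

/-! ### Reduction -/

theorem converges_daimon : Converges (Pos.daimon : Pos S) := by
  refine ⟨.refl, ?_, Pos.daimon_ne_omega⟩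
  rintro ⟨a, P, N, h⟩
  exact Pos.act_ne_daimon _ _ _ (Design.pos.inj h).symm

theorem step_cut_iff {a : S.Name} {P : S.Name → Pos S} {N : Fin (S.ar a) → Neg S} {Q : Pos S} :
    Step (Pos.act a (NegF.sum P) N) Q ↔ Q = (P a).subst (instantiate N) := by
  refine ⟨fun h => ?_, fun h => h ▸ .cut a P N⟩
  generalize hT : Pos.act a (NegF.sum P) N = T at h
  cases h with
  | cut b P' N' =>
    obtain ⟨rfl, hP, hN⟩ := Pos.act_inj hT
    obtain rfl := NegF.sum.inj hP
    obtain rfl := eq_of_heq hN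
    rfl

theorem not_converges_omega : ¬ Converges (Pos.omega : Pos S) := by
  rintro ⟨h, -, -⟩
  rcases h.cases_head with h | ⟨Q, h, -⟩
  · exact Pos.daimon_ne_omega h.symm
  · generalize hT : (Pos.omega : Pos S) = T at h
    cases h
    exact Pos.act_ne_omega _ _ _ hT.symm

/-- A cut is not the daimon and has exactly one reduct, so every reduction to the daimon passes
through that reduct. -/
theorem converges_cut_iff {a : S.Name} {P : S.Name → Pos S} {N : Fin (S.ar a) → Neg S} :
    Converges (Pos.act a (NegF.sum P) N) ↔ Converges ((P a).subst (instantiate N)) := by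
  refine ⟨fun ⟨h, h'⟩ => ⟨?_, h'⟩, fun ⟨h, h'⟩ => ⟨.head (.cut a P N) h, h'⟩⟩
  rcases h.cases_head with h | ⟨Q, hQ, h⟩
  · exact absurd h (Pos.act_ne_daimon _ _ _)
  · rwa [step_cut_iff.1 hQ] at h

/-! ### Orthogonality -/

theorem orth_daimon (N : Neg S) : Orth Pos.daimon N := by
  rw [Orth, Pos.subst_daimon]
  exact ⟨Set.eq_empty_iff_forall_notMem.2 not_freeIn_daimon, converges_daimon⟩

/-- Closed arguments are untouched by the substitution for `x₀`, so the result is a cut, closed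
because its parts are. -/
theorem orth_act_iff {a : S.Name} {M : Fin (S.ar a) → Neg S} {Q : S.Name → Pos S}
    (hM : ∀ l, (Design.neg (M l)).Closed) (hQ : (Design.neg (NegF.sum Q)).Closed) :
    Orth (Pos.act a (NegF.var 0) M) (NegF.sum Q) ↔ Converges ((Q a).subst (instantiate M)) := by
  have hsubst : (Pos.act a (NegF.var 0) M).subst (single (NegF.sum Q))
      = Pos.act a (NegF.sum Q) M := by
    rw [Pos.subst_act, NegF.subst_var]
    exact congrArg (Pos.act a _) (funext fun l => NegF.subst_of_closed (hM l) _)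
  rw [Orth, hsubst, converges_cut_iff]
  refine and_iff_right (Set.eq_empty_iff_forall_notMem.2 fun x hx => ?_)
  rcases freeIn_act_iff.1 hx with hx | ⟨l, hx⟩
  · exact Set.eq_empty_iff_forall_notMem.1 hQ x hx
  · exact Set.eq_empty_iff_forall_notMem.1 (hM l) x hx

theorem orth_iff_converges {P : Pos S} {N : Neg S} (hP : (Design.pos P).Atomic)
    (hN : (Design.neg N).Closed) : Orth P N ↔ Converges (P.subst (single N)) := by
  refine and_iff_right (Design.closed_subst fun x hx => ?_)
  obtain rfl : x = 0 := hP hx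
  exact hN

theorem subset_orthNeg_orthPos {P : Set (Pos S)}
    (h : ∀ Q ∈ P, (Design.pos Q).Standard ∧ (Design.pos Q).Atomic) : P ⊆ orthNeg (orthPos P) :=
  fun Q hQ => ⟨(h Q hQ).1, (h Q hQ).2, fun _ hN => hN.2.2 Q hQ⟩

theorem daimon_mem_orthNeg (N : Set (Neg S)) : Pos.daimon ∈ orthNeg N :=
  ⟨Design.standard_daimon, Design.atomic_daimon, fun M _ => orth_daimon M⟩

/-- Any action cut against this sum reduces to the daimon. The lemma serves to show that orthogonals
are nonempty. -/
theorem sum_daimon_mem_orthPos {P : Set (Pos S)}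
    (h : ∀ Q ∈ P, (Design.pos Q).Standard ∧ (Design.pos Q).Atomic) :
    NegF.sum (fun _ => Pos.daimon) ∈ orthPos P := by
  have hc : (Design.neg (NegF.sum fun _ => (Pos.daimon : Pos S))).Closed :=
    Design.closed_sum_iff.2 fun _ x hx => absurd hx (not_freeIn_daimon x)
  refine ⟨Design.standard_sum (fun _ => Design.locallyStandard_daimon) hc, hc, fun Q hQ => ?_⟩
  rcases (h Q hQ).1.eq_daimon_or_act (h Q hQ).2 with rfl | ⟨a, N, rfl, hN⟩
  · exact orth_daimon _
  · rw [orth_act_iff (fun l => (hN l).2) hc, Pos.subst_daimon]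
    exact converges_daimon

/-! ### Substitution in one branch of a closed sum -/

/-- The shift by `l` turns `x₀`, the only possible free variable, into the `l`-th bound variable,
which is then filled by `M l`. -/
theorem subst_rename_add_instantiate {k : ℕ} {P : Pos S} (hP : (Design.pos P).Atomic)
    (M : Fin k → Neg S) (l : Fin k) :
    (P.rename (· + l)).subst (instantiate M) = P.subst (single (M l)) := by
  rw [Pos.subst_rename]
  refine Pos.subst_congr fun x hx => ?_
  obtain rfl : x = 0 := hP hx
  simp [instantiate, single]

theorem AntiDesign.subst_toSubst {k : ℕ} {P : Pos S} (hP : ∀ x ∈ (Design.pos P).fv, x < k)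
    {G : AntiDesign S} (hG : G.base = Finset.range k) :
    P.subst G.toSubst =
      P.subst (instantiate fun l : Fin k =>
        G.design ⟨l, by rw [hG]; exact Finset.mem_range.2 l.2⟩) := by
  -- The default values of the two substitutions, `x` and `x - k`, may differ, but are used only for
  -- `x ≥ k`.
  refine Pos.subst_congr fun x hx => ?_
  have hxk := hP x hx
  have hxG : x ∈ G.base := by rw [hG]; exact Finset.mem_range.2 hxk
  simp [toSubst, instantiate, hxk, hxG]

theorem mem_orthSet_family_iff {k : ℕ} {P : Pos S} (hloc : (Design.pos P).LocallyStandard)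
    (hP : ∀ x ∈ (Design.pos P).fv, x < k) {N : Fin k → Set (Neg S)}
    (hN : ∀ l, ∀ M ∈ N l, (Design.neg M).Closed) (hne : ∀ l, (N l).Nonempty) :
    P ∈ AntiDesign.orthSet (AntiDesign.family N) ↔
      ∀ M : Fin k → Neg S, (∀ l, M l ∈ N l) → Converges (P.subst (instantiate M)) := by
  refine ⟨fun h M hM => ?_, fun h => ⟨?_, ?_⟩⟩
  · let G : AntiDesign S :=
      ⟨Finset.range k, fun x => M ⟨x, Finset.mem_range.1 x.2⟩, fun x => hN _ _ (hM _)⟩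
    have := (h.2 G ⟨rfl, hM⟩).2
    rwa [AntiDesign.subst_toSubst hP (G := G) rfl] at this
  -- Nonemptiness gives one convergent instance, which rules out `P = Ω`.
  · choose M hM using hne
    refine Design.standard_iff.2 ⟨hloc, fun x hx => (by cases hx), ?_,
      (Set.finite_lt_nat k).subset hP⟩
    intro hΩ
    obtain rfl := Design.pos.inj hΩ
    have := h M hM
    rw [Pos.subst_omega] at this
    exact not_converges_omega this
  · rintro G ⟨hG, hGN⟩
    refine ⟨Design.closed_subst fun x hx => ?_, ?_⟩
    · have hxG : x ∈ G.base := by rw [hG]; exact Finset.mem_range.2 (hP x hx)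
      rw [AntiDesign.toSubst, dif_pos hxG]
      exact G.atomic _
    · rw [AntiDesign.subst_toSubst hP hG]
      exact h _ hGN

/-! ### Internal completeness -/

variable {n : ℕ}

/-- The union of the sets `ā⟨𝐍_{(i,1)},…,𝐍_{(i,k)}⟩` over a set of actions. -/
def actUnion (I : Set (NegAction S n)) (N : Fin n → Set (Neg S)) : Set (Pos S) :=
  ⋃ p ∈ I, actSet p.name fun l => N (p.vars l)

theorem mem_actUnion_iff {I : Set (NegAction S n)} {N : Fin n → Set (Neg S)} {P : Pos S} :
    P ∈ actUnion I N ↔ ∃ p ∈ I, ∃ M : Fin (S.ar p.name) → Neg S,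
      (∀ l, M l ∈ N (p.vars l)) ∧ P = Pos.act p.name (NegF.var 0) M := by
  simp [actUnion, actSet]

/-- Produces the probing sums: convergence matters only in branches named by `I`, and any other
branch may even be `Ω`. -/
theorem sum_mem_orthPos_actUnion {I : Set (NegAction S n)} {N : Fin n → Set (Neg S)}
    (hN : ∀ j, ∀ M ∈ N j, (Design.neg M).Closed) {Q : S.Name → Pos S}
    (hloc : ∀ a, (Design.pos (Q a)).LocallyStandard) (hc : (Design.neg (NegF.sum Q)).Closed)
    (h : ∀ p ∈ I, ∀ M : Fin (S.ar p.name) → Neg S, (∀ l, M l ∈ N (p.vars l)) →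
      Converges ((Q p.name).subst (instantiate M))) :
    NegF.sum Q ∈ orthPos (actUnion I N) := by
  refine ⟨Design.standard_sum hloc hc, hc, fun P hP => ?_⟩
  obtain ⟨p, hp, M, hM, rfl⟩ := mem_actUnion_iff.1 hP
  exact (orth_act_iff (fun l => hN _ _ (hM l)) hc).2 (h p hp M hM)

/-- The name of an action in the biorthogonal of a union is the name of a member. -/
theorem name_mem_of_act_mem_biorthogonal {I : Set (NegAction S n)} {N : Fin n → Set (Neg S)}
    (hN : ∀ j, ∀ M ∈ N j, (Design.neg M).Closed) {a : S.Name} {M : Fin (S.ar a) → Neg S}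
    (hM : ∀ l, (Design.neg (M l)).Closed)
    (h : Pos.act a (NegF.var 0) M ∈ orthNeg (orthPos (actUnion I N))) :
    ∃ p ∈ I, p.name = a := by
  classical
  by_contra! ha
  -- If no action in `I` is named `a`, the union never meets the `Ω` branch, but the given action
  -- does.
  let Q (b : S.Name) : Pos S := if b = a then Pos.omega else Pos.daimon
  have hc : (Design.neg (NegF.sum Q)).Closed := by
    refine Design.closed_sum_iff.2 fun b x hx => ?_
    dsimp only [Q] at hx
    split_ifs at hx
    · exact absurd hx (not_freeIn_omega x)
    · exact absurd hx (not_freeIn_daimon x)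
  have hQ : NegF.sum Q ∈ orthPos (actUnion I N) := by
    refine sum_mem_orthPos_actUnion hN (fun b => ?_) hc fun p hp M hM => ?_
    · dsimp only [Q]
      split_ifs
      · exact Design.locallyStandard_omega
      · exact Design.locallyStandard_daimon
    · rw [show Q p.name = Pos.daimon from if_neg (ha p hp), Pos.subst_daimon]
      exact converges_daimon
  have := (orth_act_iff hM hc).1 (h.2.2 _ hQ)
  rw [show Q a = Pos.omega from if_pos rfl, Pos.subst_omega] at this
  exact not_converges_omega this

/-- The arguments of an action in the biorthogonal of a union belong to the biorthogonals. -/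
theorem arg_mem_of_act_mem_biorthogonal {I : Set (NegAction S n)}
    (hI : Set.InjOn NegAction.name I) {N : Fin n → Set (Neg S)}
    (hN : ∀ j, ∀ M ∈ N j, (Design.neg M).Closed) {p : NegAction S n} (hp : p ∈ I)
    {M : Fin (S.ar p.name) → Neg S}
    (hM : ∀ l, (Design.neg (M l)).Standard ∧ (Design.neg (M l)).Closed)
    (h : Pos.act p.name (NegF.var 0) M ∈ orthNeg (orthPos (actUnion I N)))
    (l : Fin (S.ar p.name)) : M l ∈ orthPos (orthNeg (N (p.vars l))) := by
  classical
  refine ⟨(hM l).1, (hM l).2, fun R hR => ?_⟩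
  -- The branch at `p.name` runs `R` against the `l`-th argument and ignores the others.
  let Q (b : S.Name) : Pos S := if b = p.name then R.rename (· + l) else Pos.daimon
  have hQp : Q p.name = R.rename (· + l) := if_pos rfl
  have hc : (Design.neg (NegF.sum Q)).Closed := by
    refine Design.closed_sum_iff.2 fun b x hx => ?_
    dsimp only [Q] at hx
    split_ifs at hx with hb
    · obtain ⟨y, hy, rfl⟩ := FreeIn.of_rename hx (T := .pos R) rfl
      obtain rfl : y = 0 := hR.2.1 hy
      subst hb
      simp
    · exact absurd hx (not_freeIn_daimon x)
  have hQ : NegF.sum Q ∈ orthPos (actUnion I N) := by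
    refine sum_mem_orthPos_actUnion hN (fun b => ?_) hc fun q hq M' hM' => ?_
    · dsimp only [Q]
      split_ifs
      · exact (Design.standard_iff.1 hR.1).1.rename (add_left_injective _)
      · exact Design.locallyStandard_daimon
    · by_cases hqp : q.name = p.name
      · obtain rfl := hI hq hp hqp
        rw [hQp, subst_rename_add_instantiate hR.2.1]
        exact (hR.2.2 _ (hM' l)).2
      · rw [show Q q.name = Pos.daimon from if_neg hqp, Pos.subst_daimon]
        exact converges_daimon
  have := (orth_act_iff (fun l => (hM l).2) hc).1 (h.2.2 _ hQ)
  rw [hQp, subst_rename_add_instantiate hR.2.1] at this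
  exact (orth_iff_converges hR.2.1 (hM l).2).2 this

theorem orthNeg_orthPos_actUnion {I : Set (NegAction S n)} (hI : Set.InjOn NegAction.name I)
    {N : Fin n → Set (Neg S)} (hN : ∀ j, IsNegABehaviour (N j)) :
    orthNeg (orthPos (actUnion I N)) = actUnion I N ∪ {Pos.daimon} := by
  have hc : ∀ j, ∀ M ∈ N j, (Design.neg M).Closed := fun j M hM => ((hN j).1 M hM).2
  refine Set.Subset.antisymm (fun P hP => ?_) (Set.union_subset ?_ ?_)
  · rcases hP.1.eq_daimon_or_act hP.2.1 with rfl | ⟨a, M, rfl, hM⟩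
    · exact .inr rfl
    · obtain ⟨p, hp, rfl⟩ := name_mem_of_act_mem_biorthogonal hc (fun l => (hM l).2) hP
      refine .inl (mem_actUnion_iff.2 ⟨p, hp, M, fun l => ?_, rfl⟩)
      rw [(hN (p.vars l)).2]
      exact arg_mem_of_act_mem_biorthogonal hI hc hp hM hP l
  · refine subset_orthNeg_orthPos fun P hP => ?_
    obtain ⟨p, -, M, hM, rfl⟩ := mem_actUnion_iff.1 hP
    exact Design.standard_act fun l => (hN _).1 _ (hM l)
  · rintro _ rfl
    exact daimon_mem_orthNeg _

/-! ### Dual decomposability -/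

namespace Connective

/-- Since `𝐍_j^⊥⊥ = 𝐍_j`, harmony identifies the counter set with the union whose biorthogonal is
`elimBehaviour`; internal completeness then applies. -/
theorem elimBehaviour_eq (α : Connective S n) (h : α.Harmony) {N : Fin n → Set (Neg S)}
    (hN : ∀ j, IsNegABehaviour (N j)) :
    α.elimBehaviour N = α.introCounterSet (fun j => orthNeg (N j)) ∪ {Pos.daimon} := by
  have hcounter : α.introCounterSet (fun j => orthNeg (N j)) = actUnion α.elim N := by
    rw [Set.Subset.antisymm h.1 h.2, actUnion, introCounterSet]
    simp only [← (hN _).2]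
  rw [hcounter]
  exact orthNeg_orthPos_actUnion (α.name_injOn.mono Set.subset_union_right) hN

theorem sum_mem_introBehaviour_iff (α : Connective S n) (h : α.Harmony)
    {P : Fin n → Set (Pos S)} (hP : ∀ j, IsPosABehaviour (P j)) {Q : S.Name → Pos S}
    (hQ : (Design.neg (NegF.sum Q)).Standard) (hQc : (Design.neg (NegF.sum Q)).Atomic) :
    NegF.sum Q ∈ α.introBehaviour P ↔
      ∀ p ∈ α.elim,
        Q p.name ∈ AntiDesign.orthSet (AntiDesign.family fun l => orthPos (P (p.vars l))) := by
  -- For each action separately, both sides say that the branch converges under all arguments from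
  -- the orthogonals.
  have hbranch : ∀ p ∈ α.elim, (NegF.sum Q ∈ orthPos (actSet p.name fun l =>
      orthPos (P (p.vars l))) ↔
        Q p.name ∈ AntiDesign.orthSet (AntiDesign.family fun l => orthPos (P (p.vars l)))) := by
    intro p _
    rw [mem_orthSet_family_iff ((Design.standard_iff.1 hQ).1.mono (.branch p.name .refl))
      (Design.closed_sum_iff.1 hQc p.name) (fun l M hM => hM.2.1)
      fun l => ⟨_, sum_daimon_mem_orthPos (hP (p.vars l)).1⟩]
    constructor
    · exact fun hmem M hM => (orth_act_iff (fun l => (hM l).2.1) hQc).1 (hmem.2.2 _ ⟨M, hM, rfl⟩)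
    · rintro hconv
      refine ⟨hQ, hQc, ?_⟩
      rintro _ ⟨M, hM, rfl⟩
      exact (orth_act_iff (fun l => (hM l).2.1) hQc).2 (hconv M hM)
  rw [introBehaviour, Set.Subset.antisymm h.2 h.1]
  exact ⟨fun hmem p hp => (hbranch p hp).1 (hmem.2.2 p hp),
    fun hmem => ⟨hQ, hQc, fun p hp => (hbranch p hp).2 (hmem p hp)⟩⟩

end Connective

end Ludics

theorem mainTheorem4 {S : Ludics.Signature.{u}} {n : ℕ} (α : Ludics.Connective S n)
    (h : α.Harmony) : α.DuallyDecomposable :=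
  ⟨fun _ hN => α.elimBehaviour_eq h hN,
    fun _ hP _ hQ hQc => α.sum_mem_introBehaviour_iff h hP hQ hQc⟩
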